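/- Let $K$ be an algebraic number field in which $-1$ is not a square, and let $n = 2^{\alpha}k$ with $\alpha \ge 2$ and $k$ odd. Then there exists a cyclic Galois extension $L/K$ of degree $n$ in which $-1$ is not a square. For every such $L$ and every generator $\sigma$ of $\mathrm{Gal}(L/K)$ the following holds. Let $\mathrm{Alt}_K(L)$ be the space of alternating $K$-bilinear forms on $L$. For $\tau\in\mathrm{Gal}(L/K)$ and $b \in L$ put $f_{b,\tau}(x,y) = \mathrm{Tr}_{L/K}\bigl(b(x\tau(y)-\tau(x)y)\bigr)$. Let $A^i = \{f_{b,\sigma^i} : b\in L\}$ and $B^1 = A^{n/2}$, and write $o_i = \mathrm{ord}(\sigma^i)$. Call a $K$-subspace of $\mathrm{Alt}_K(L)$ an $r$-subspace if all its nonzero forms have rank $r$. There are subspaces $\mathcal E^i_j, \mathcal V^i_1, \mathcal V^i_2, \mathcal U_i, \mathcal V_i$ such that: 1. If $o_i = 2^{\beta}k'$ with $\beta\ge 2$ and $k'$ odd, then $$A^i = \mathcal V_1^i\oplus\mathcal V_2^i\oplus\mathcal E_1^i\oplus\cdots\oplus\mathcal E_{\beta-1}^i,$$ where $\mathcal E_j^i$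 is an $n$-subspace of dimension $n/2^j$ for $1\le j\le \beta-1$, and $\mathcal V_1^i,\mathcal V_2^i$ are $(n-2n/o_i)$-subspaces of dimension $k'n/o_i$. 2. If $o_i\equiv 2 \pmod 4$ and $o_i\neq 2$, then $A^i=\mathcal U_i\oplus\mathcal V_i$, where $\mathcal U_i$ is an $n$-subspace and $\mathcal V_i$ is an $(n-2n/o_i)$-subspace, both of dimension $n/2$. If $o_i>1$ is odd, then $A^i$ is an $(n-n/o_i)$-subspace of dimension $n$. Moreover $B^1$ is an $n$-subspace of dimension $n/2$. 3. With the same subspaces, there is a direct decomposition into constant-rank subspaces $$\mathrm{Alt}_K(L)= B^1\oplus\bigoplus_{\substack{o_i\equiv 2\,(4)\\ o_i\ne 2}}(\mathcal U_i\oplus\mathcal V_i)\oplus\bigoplus_{o_i \text{ odd}}A^i\oplus\bigoplus_{o_i\equiv 0\,(4)}\bigl(\mathcal V_1^i\oplus\mathcal V_2^i\oplus\mathcal E^i_1\oplus\cdots\oplus\mathcal E^i_{\beta_i-1}\bigr),$$ where $i$ runs over $1\le i\le n/2-1$ and, in the last sum, $2^{\beta_i}$ is the exact power of $2$ dividing $o_i$.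 -/

import Mathlib

universe u v

/-- The space `Alt_K(L)` of alternating `K`-bilinear forms on `L`, as a subspace of the space of
all `K`-bilinear forms on `L`. -/
def altForms (K L : Type*) [Field K] [Field L] [Algebra K L] :
    Submodule K (LinearMap.BilinForm K L) where
  carrier := {f | ∀ x, f x x = 0}
  add_mem' := fun {f g} hf hg x => by
    have h1 : f x x = 0 := hf x
    have h2 : g x x = 0 := hg x
    simp [h1, h2]
  zero_mem' := fun x => by simp
  smul_mem' := fun c f hf x => by
    have h1 : f x x = 0 := hf x
    simp [h1]

/-- The skew-form `f_{b,σ}(x, y) = Tr_{L/K}(b (x σ(y) - σ(x) y))`. -/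
noncomputable def skewForm {K L : Type*} [Field K] [Field L] [Algebra K L]
    (σ : L ≃ₐ[K] L) (b : L) : LinearMap.BilinForm K L :=
  LinearMap.mk₂ K (fun x y => Algebra.trace K L (b * (x * σ y - σ x * y)))
    (fun x x' y => by rw [← map_add, map_add σ]; congr 1; ring)
    (fun c x y => by
      rw [← map_smul, map_smul σ]; congr 1
      simp only [Algebra.smul_def]; ring)
    (fun x y y' => by rw [← map_add, map_add σ]; congr 1; ring)
    (fun c x y => by
      rw [← map_smul, map_smul σ]; congr 1
      simp only [Algebra.smul_def]; ring)

/-- The space `A^σ = {f_{b,σ} : b ∈ L}`. -/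
noncomputable def skewSpace {K L : Type*} [Field K] [Field L] [Algebra K L]
    (σ : L ≃ₐ[K] L) : Submodule K (LinearMap.BilinForm K L) where
  carrier := {f | ∃ b : L, f = skewForm σ b}
  add_mem' := by
    rintro _ _ ⟨b, rfl⟩ ⟨c, rfl⟩
    refine ⟨b + c, ?_⟩
    ext x y
    simp [skewForm, add_mul]
  zero_mem' := ⟨0, by ext x y; simp [skewForm]⟩
  smul_mem' := by
    rintro c _ ⟨b, rfl⟩
    refine ⟨c • b, ?_⟩
    ext x y
    simp [skewForm]

/-- `W` is an `r`-subspace of dimension `d`: every nonzero form in `W` has rank `r`, and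
`dim_K W = d`. -/
def IsRankSubspace {K L : Type*} [Field K] [Field L] [Algebra K L]
    (W : Submodule K (LinearMap.BilinForm K L)) (r d : ℕ) : Prop :=
  (∀ f ∈ W, f ≠ 0 → Module.finrank K (LinearMap.range f) = r) ∧ Module.finrank K W = d

/-- `A` is the internal direct sum of the subspaces `W j`. -/
def IsDirectSumOf {K M ι : Type*} [Field K] [AddCommMonoid M] [Module K M]
    (A : Submodule K M) (W : ι → Submodule K M) : Prop :=
  iSupIndep W ∧ ⨆ j, W j = A

/-- Labels of the summands in the decomposition of `Alt_K(L)` for a cyclic extension of even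
degree `n` with Galois group generated by `σ`.  The index `i` runs over `1, …, n / 2 - 1`, so that
the `σ ^ i` represent the pairs `{τ, τ⁻¹}` of elements of order greater than two. -/
inductive SummandLabel {G : Type*} [Group G] (n : ℕ) (σ : G) : Type
  | invol : SummandLabel n σ
  | twoU (i : ℕ) (hi : 1 ≤ i ∧ i < n / 2)
      (h : orderOf (σ ^ i) % 4 = 2 ∧ orderOf (σ ^ i) ≠ 2) : SummandLabel n σ
  | twoV (i : ℕ) (hi : 1 ≤ i ∧ i < n / 2)
      (h : orderOf (σ ^ i) % 4 = 2 ∧ orderOf (σ ^ i) ≠ 2) : SummandLabel n σ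
  | odd (i : ℕ) (hi : 1 ≤ i ∧ i < n / 2) (h : orderOf (σ ^ i) % 2 = 1) : SummandLabel n σ
  | fourV (i : ℕ) (hi : 1 ≤ i ∧ i < n / 2) (h : orderOf (σ ^ i) % 4 = 0)
      (j : Fin 2) : SummandLabel n σ
  | fourE (i : ℕ) (hi : 1 ≤ i ∧ i < n / 2) (h : orderOf (σ ^ i) % 4 = 0)
      (j : ℕ) (hj : 1 ≤ j ∧ j ≤ padicValNat 2 (orderOf (σ ^ i)) - 1) : SummandLabel n σ

/-- The summand with a given label: `B^1 = A^{σ^(n/2)}`; `U_i` and `V_i` if `ord(σ^i) ≡ 2 mod 4`;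
`A^i` if `ord(σ^i)` is odd; `V_1^i, V_2^i, E_1^i, …, E_{β-1}^i` if `ord(σ^i) = 2^β k'` with
`β ≥ 2` and `k'` odd. -/
noncomputable def summand {K L : Type*} [Field K] [Field L] [Algebra K L] (n : ℕ) (σ : L ≃ₐ[K] L)
    (U V : ℕ → Submodule K (LinearMap.BilinForm K L))
    (V' : ℕ → Fin 2 → Submodule K (LinearMap.BilinForm K L))
    (E : ℕ → ℕ → Submodule K (LinearMap.BilinForm K L)) :
    SummandLabel n σ → Submodule K (LinearMap.BilinForm K L)
  | .invol => skewSpace (σ ^ (n / 2))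
  | .twoU i _ _ => U i
  | .twoV i _ _ => V i
  | .odd i _ _ => skewSpace (σ ^ i)
  | .fourV i _ _ j => V' i j
  | .fourE i _ _ j _ => E i j

/-! ### Direct sums of subspaces: a triangular criterion, refinement, transport. -/

section DirectSums

variable {K M : Type*} [Field K] [AddCommGroup M] [Module K M]

/-! Nondegeneracy of the trace form reduces every rank to one equation: `x` lies in the radical of
`f_{b,τ}` iff `b x = τ(b) τ²(x)` (`mem_ker_skewForm`). Each summand of `A^τ` is the image under `b ↦
f_{b,τ}` (injective when `τ² ≠ 1`) of an eigenspace of a power of `τ` for an eigenvalue `±1`, and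
the radical depends on the parity of that power.

If `τ^h b = ε b` with `h` odd, a partial norm `y` of `b` under `τ²` turns the equation into `τ²(yx)
= ε yx`, so the radical has the dimension of the `ε`-eigenspace of `τ²` (`finrank_ker_skewForm`). If
`τ^(2q) b = -b` and `τ` has order dividing `2^(j+1) q`, a nonzero solution forces a partial norm `w`
of `τ(b)/b` to satisfy `w^(2^j) = 1`. As `-1` is not a square in `L`, `w = ±1`, whereas `w τ(w) =
-1`; so the radical is zero (`ker_skewForm_eq_bot`).

The splitting of each `A^τ` comes from iterating `Fix(g²) = Fix(g) ⊕ {g x = -x}`. The splitting of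
`Alt_K(L)` comes from Dedekind independence: every bilinear form is uniquely `Tr(x ∑ c_g g(y))`, and
antisymmetrizing shows that the `A^g` span, one from each pair `{g, g⁻¹}` being enough.

For existence, put `F = K(√-1)`. For a large prime `p ≡ 1 mod n`, the polynomial `Φ_p` stays
irreducible over `F`, so `√-1 ∉ K(ζ_p)` by degrees, and the cyclic field `K(ζ_p)` contains an
extension of `K` of degree `n`. -/

theorem iSupIndep_of_injective_rank {ι : Type*} {W : ι → Submodule K M} (r : ι → ℕ)
    (hr : Function.Injective r) (F : ι → Submodule K M) (hd : ∀ j, Disjoint (W j) (F j))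
    (hF : ∀ j k, r j < r k → W k ≤ F j) : iSupIndep W := by
  classical
  rw [iSupIndep_iff_finsetSum_eq_zero_imp_eq_zero]
  intro s v hv h0
  by_contra! hne
  obtain ⟨i, hi, hi0⟩ := hne
  have hs : (s.filter (fun i => v i ≠ 0)).Nonempty := ⟨i, by simp [hi, hi0]⟩
  -- Among the nonzero terms take the one of least rank: all the others lie in `F j`, hence so does
  -- this one, against disjointness.
  obtain ⟨j, hj, hmin⟩ := Finset.exists_min_image _ r hs
  simp only [Finset.mem_filter] at hj hmin
  apply hj.2
  apply (Submodule.disjoint_def.1 (hd j)) _ (hv j hj.1)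
  rw [← Finset.add_sum_erase _ _ hj.1, add_eq_zero_iff_eq_neg] at h0
  rw [h0]
  refine Submodule.neg_mem _ (Submodule.sum_mem _ fun k hk => ?_)
  rw [Finset.mem_erase] at hk
  by_cases hk0 : v k = 0
  · rw [hk0]; exact zero_mem _
  · exact hF j k (lt_of_le_of_ne (hmin k ⟨hk.2, hk0⟩) fun h => hk.1 (hr h).symm) (hv k hk.2)

/-- Associativity of direct sums for a flat index type: `p` sends a label to its block, and `g k`
parametrizes the labels of block `k`. -/
theorem IsDirectSumOf.refine {κ ι : Type*} {J : κ → Type*} {A : Submodule K M}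
    {B : κ → Submodule K M} (hB : IsDirectSumOf A B) {W : ι → Submodule K M} (p : ι → κ)
    {W' : ∀ k, J k → Submodule K M} (hW' : ∀ k, IsDirectSumOf (B k) (W' k))
    (g : ∀ k, J k → ι) (hg : ∀ k, Function.Injective (g k))
    (hp : ∀ i k, p i = k ↔ i ∈ Set.range (g k)) (hW : ∀ k j, W (g k j) = W' k j) :
    IsDirectSumOf A W := by
  classical
  have hle : ∀ i, W i ≤ B (p i) := fun i => by
    obtain ⟨j, hj⟩ := (hp i _).1 rfl
    rw [← (hW' (p i)).2, ← hj, hW]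
    conv_rhs => rw [hj]
    exact le_iSup (W' (p i)) j
  constructor
  · rw [iSupIndep_iff_finsetSum_eq_zero_imp_eq_zero]
    intro s v hv h0 i hi
    have h1 := (iSupIndep_iff_finsetSum_eq_zero_imp_eq_zero _).1 hB.1 (s.image p)
      (fun k => ∑ i ∈ s with p i = k, v i)
      (fun k _ => Submodule.sum_mem _ fun i hi => by
        rw [Finset.mem_filter] at hi
        exact hi.2 ▸ hle i (hv i hi.1))
      ((Finset.sum_fiberwise_of_maps_to (fun i hi => Finset.mem_image_of_mem p hi) v).trans h0)
      (p i) (Finset.mem_image_of_mem _ hi)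
    have h2 := (iSupIndep_iff_finsetSum_eq_zero_imp_eq_zero _).1 (hW' (p i)).1
      (s.preimage (g (p i)) (hg _).injOn) (v ∘ g (p i))
      (fun j hj => by
        rw [Finset.mem_preimage] at hj
        rw [← hW]; exact hv _ hj)
      (by
        rw [← h1]
        refine (Finset.sum_preimage' (g (p i)) s (hg _).injOn v).trans ?_
        refine Finset.sum_congr (Finset.filter_congr fun x _ => (hp x _).symm) fun _ _ => rfl)
    obtain ⟨j, hj⟩ := (hp i _).1 rfl
    have := h2 j (by rw [Finset.mem_preimage, hj]; exact hi)
    rwa [Function.comp_apply, hj] at this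
  · rw [← hB.2]
    apply le_antisymm
    · exact iSup_le fun i => (hle i).trans (le_iSup B _)
    · refine iSup_le fun k => ?_
      rw [← (hW' k).2]
      exact iSup_le fun j => by rw [← hW]; exact le_iSup W _

theorem IsDirectSumOf.map {N : Type*} [AddCommGroup N] [Module K N] {ι : Type*}
    {A : Submodule K M} {W : ι → Submodule K M} (h : IsDirectSumOf A W) (f : M →ₗ[K] N)
    (hf : Function.Injective f) : IsDirectSumOf (A.map f) (fun i => (W i).map f) := by
  constructor
  · rw [iSupIndep_iff_finsetSum_eq_zero_imp_eq_zero]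
    intro s v hv h0 i hi
    choose! u hu using fun i (hi : i ∈ s) => Submodule.mem_map.1 (hv i hi)
    have h1 : ∑ i ∈ s, u i = 0 := hf (by
      rw [map_sum, map_zero, ← h0]
      exact Finset.sum_congr rfl fun i hi => (hu i hi).2)
    rw [← (hu i hi).2, (iSupIndep_iff_finsetSum_eq_zero_imp_eq_zero _).1 h.1 s u
      (fun i hi => (hu i hi).1) h1 i hi, map_zero]
  · rw [← h.2, Submodule.map_iSup]

end DirectSums

/-! ### Eigenspaces of automorphisms for the eigenvalues 1 and -1. -/

section Eigenspaces

variable {K L : Type*} [Field K] [Field L] [Algebra K L]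

/-- The `ε`-eigenspace of an automorphism, as a subspace over the base field. -/
noncomputable def autEigenspace (g : L ≃ₐ[K] L) (ε : K) : Submodule K L :=
  Module.End.eigenspace g.toLinearMap ε

theorem mem_autEigenspace {g : L ≃ₐ[K] L} {ε : K} {x : L} :
    x ∈ autEigenspace g ε ↔ g x = ε • x := Module.End.mem_eigenspace_iff

theorem mem_autEigenspace_one {g : L ≃ₐ[K] L} {x : L} :
    x ∈ autEigenspace g (1 : K) ↔ g x = x := by rw [mem_autEigenspace, one_smul]

theorem mem_autEigenspace_neg_one {g : L ≃ₐ[K] L} {x : L} :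
    x ∈ autEigenspace g (-1 : K) ↔ g x = -x := by rw [mem_autEigenspace, neg_one_smul]

theorem disjoint_autEigenspace [CharZero K] (g : L ≃ₐ[K] L) :
    Disjoint (autEigenspace g (-1 : K)) (autEigenspace g (1 : K)) := by
  have : CharZero L := charZero_of_injective_algebraMap (algebraMap K L).injective
  rw [Submodule.disjoint_def]
  intro x h1 h2
  rw [mem_autEigenspace_neg_one] at h1
  rw [mem_autEigenspace_one] at h2
  rw [h2] at h1
  exact self_eq_neg.1 h1

theorem autEigenspace_pow_two [CharZero K] (g : L ≃ₐ[K] L) :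
    autEigenspace (g ^ 2) (1 : K) = autEigenspace g (-1 : K) ⊔ autEigenspace g (1 : K) := by
  apply le_antisymm
  · intro x hx
    rw [mem_autEigenspace_one, pow_two, AlgEquiv.mul_apply] at hx
    have h2 : ((2 : K)⁻¹ • (x - g x)) + ((2 : K)⁻¹ • (x + g x)) = x := by
      rw [← smul_add, sub_add_add_cancel, ← two_smul K x, smul_smul, inv_mul_cancel₀ two_ne_zero,
        one_smul]
    rw [← h2]
    refine Submodule.add_mem_sup ?_ ?_
    · rw [mem_autEigenspace_neg_one, map_smul, map_sub, hx, ← smul_neg, neg_sub]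
    · rw [mem_autEigenspace_one, map_smul, map_add, hx, add_comm]
  · refine sup_le (fun x hx => ?_) fun x hx => ?_
    · rw [mem_autEigenspace_neg_one] at hx
      rw [mem_autEigenspace_one, pow_two, AlgEquiv.mul_apply, hx, map_neg, hx, neg_neg]
    · rw [mem_autEigenspace_one] at hx
      rw [mem_autEigenspace_one, pow_two, AlgEquiv.mul_apply, hx, hx]

theorem pow_apply_of_mem_autEigenspace {g : L ≃ₐ[K] L} {ε : K} {x : L}
    (hx : x ∈ autEigenspace g ε) (m : ℕ) : (g ^ m) x = ε ^ m • x := by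
  rw [mem_autEigenspace] at hx
  induction m with
  | zero => simp
  | succ m ih => rw [pow_succ', AlgEquiv.mul_apply, ih, map_smul, hx, smul_smul, pow_succ]

variable [FiniteDimensional K L] [IsGalois K L]

theorem finrank_autEigenspace_one_mul (g : L ≃ₐ[K] L) :
    Module.finrank K (autEigenspace g (1 : K)) * orderOf g = Module.finrank K L := by
  have h : autEigenspace g (1 : K) =
      Subalgebra.toSubmodule (IntermediateField.fixedField (Subgroup.zpowers g)).toSubalgebra := by
    ext x
    rw [mem_autEigenspace_one, Subalgebra.mem_toSubmodule,
      IntermediateField.mem_toSubalgebra, IntermediateField.mem_fixedField_iff]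
    constructor
    · intro hx f hf
      obtain ⟨m, rfl⟩ := Subgroup.mem_zpowers_iff.1 hf
      exact zpow_induction_right (P := fun f : L ≃ₐ[K] L => f x = x) rfl
        (fun f hf => by rw [AlgEquiv.mul_apply, hx, hf])
        (fun f hf => by
          rw [AlgEquiv.mul_apply]
          conv_lhs => rw [← hx]
          rw [← AlgEquiv.mul_apply g⁻¹, inv_mul_cancel]; exact hf) m
    · exact fun h => h g (Subgroup.mem_zpowers g)
  rw [h, ← Nat.card_zpowers, ← IntermediateField.finrank_fixedField_eq_card]
  exact Module.finrank_mul_finrank K (IntermediateField.fixedField (Subgroup.zpowers g)) L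

theorem finrank_autEigenspace_one (g : L ≃ₐ[K] L) :
    Module.finrank K (autEigenspace g (1 : K)) = Module.finrank K L / orderOf g := by
  rw [← finrank_autEigenspace_one_mul g, Nat.mul_div_cancel _ (orderOf_pos g)]

/-- The eigenspace is a complement of `Fix(g)` in `Fix(g²)`, which is twice as large because `g²`
has half the order of `g`. -/
theorem finrank_autEigenspace_neg_one [CharZero K] (g : L ≃ₐ[K] L) (hg : Even (orderOf g)) :
    Module.finrank K (autEigenspace g (-1 : K)) = Module.finrank K L / orderOf g := by
  have h1 := Submodule.finrank_sup_add_finrank_inf_eq (autEigenspace g (-1 : K))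
    (autEigenspace g (1 : K))
  rw [(disjoint_autEigenspace g).eq_bot, finrank_bot, ← autEigenspace_pow_two,
    finrank_autEigenspace_one g] at h1
  have h2 := finrank_autEigenspace_one_mul (g ^ 2)
  have h3 := finrank_autEigenspace_one_mul g
  rw [finrank_autEigenspace_one g] at h3
  have h4 : orderOf g = 2 * orderOf (g ^ 2) := by
    obtain ⟨m, hm⟩ := hg
    rw [orderOf_pow' g two_ne_zero, Nat.gcd_eq_right ⟨m, by omega⟩]; omega
  have h5 : 0 < orderOf (g ^ 2) := orderOf_pos _
  have : Module.finrank K (autEigenspace (g ^ 2) (1 : K)) = 2 * (Module.finrank K L / orderOf g) := by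
    apply Nat.eq_of_mul_eq_mul_right h5
    rw [h2, mul_right_comm, ← h4, mul_comm, h3]
  omega

omit [FiniteDimensional K L] [IsGalois K L] in
theorem autEigenspace_neg_one_eq_bot [CharZero K] (g : L ≃ₐ[K] L) (hg : Odd (orderOf g)) :
    autEigenspace g (-1 : K) = ⊥ := by
  have : CharZero L := charZero_of_injective_algebraMap (algebraMap K L).injective
  rw [eq_bot_iff]
  intro x hx
  have := pow_apply_of_mem_autEigenspace hx (orderOf g)
  rw [pow_orderOf_eq_one, hg.neg_one_pow, neg_one_smul, AlgEquiv.one_apply] at this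
  exact self_eq_neg.1 this

end Eigenspaces

/-! ### Partial norms along the powers of an automorphism. -/

section TwistedProducts

variable {K L : Type*} [Field K] [Field L] [Algebra K L]

/-- The partial norm `v * g v * ⋯ * g ^ (m - 1) v`. -/
noncomputable def partialNorm (g : L ≃ₐ[K] L) (v : L) (m : ℕ) : L :=
  ∏ i ∈ Finset.range m, (g ^ i) v

theorem partialNorm_succ (g : L ≃ₐ[K] L) (v : L) (m : ℕ) :
    partialNorm g v (m + 1) = partialNorm g v m * (g ^ m) v := Finset.prod_range_succ _ _

theorem partialNorm_add (g : L ≃ₐ[K] L) (v : L) (a b : ℕ) :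
    partialNorm g v (a + b) = partialNorm g v a * (g ^ a) (partialNorm g v b) := by
  simp only [partialNorm, Finset.prod_range_add, map_prod, pow_add, AlgEquiv.mul_apply]

theorem map_partialNorm_mul (g : L ≃ₐ[K] L) (v : L) (m : ℕ) :
    g (partialNorm g v m) * v = partialNorm g v m * (g ^ m) v := by
  rw [← partialNorm_succ, add_comm, partialNorm_add, pow_one, mul_comm]
  simp [partialNorm]

theorem partialNorm_ne_zero (g : L ≃ₐ[K] L) {v : L} (hv : v ≠ 0) (m : ℕ) :
    partialNorm g v m ≠ 0 :=
  Finset.prod_ne_zero_iff.2 fun i _ => (map_ne_zero (g ^ i)).2 hv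

theorem partialNorm_div (g : L ≃ₐ[K] L) (u v : L) (m : ℕ) :
    partialNorm g (u / v) m = partialNorm g u m / partialNorm g v m := by
  simp only [partialNorm, map_div₀, Finset.prod_div_distrib]

theorem partialNorm_map_div_self (g : L ≃ₐ[K] L) {b : L} (hb : b ≠ 0) (m : ℕ) :
    partialNorm g (g b / b) m = (g ^ m) b / b := by
  induction m with
  | zero => simp [partialNorm, hb]
  | succ m ih =>
    have h : (g ^ m) b ≠ 0 := (map_ne_zero (g ^ m)).2 hb
    rw [partialNorm_succ, ih, map_div₀, ← AlgEquiv.mul_apply (g ^ m) g, ← pow_succ]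
    field_simp

theorem partialNorm_mul_of_fixed (g : L ≃ₐ[K] L) {v : L} {q : ℕ} (hv : (g ^ q) v = v) (t : ℕ) :
    partialNorm g v (t * q) = partialNorm g v q ^ t := by
  have hw : (g ^ q) (partialNorm g v q) = partialNorm g v q := by
    simp only [partialNorm, map_prod]
    refine Finset.prod_congr rfl fun i _ => ?_
    rw [← AlgEquiv.mul_apply, ← pow_add, add_comm, pow_add, AlgEquiv.mul_apply, hv]
  induction t with
  | zero => simp [partialNorm]
  | succ t ih =>
    have h : ∀ t : ℕ, (g ^ (t * q)) (partialNorm g v q) = partialNorm g v q := fun t => by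
      induction t with
      | zero => simp
      | succ t ih => rw [Nat.succ_mul, pow_add, AlgEquiv.mul_apply, hw, ih]
    rw [Nat.succ_mul, partialNorm_add, ih, h, pow_succ]

/-- Separate the factors with even and with odd exponent. -/
theorem partialNorm_two_mul (g : L ≃ₐ[K] L) (v : L) (q : ℕ) :
    partialNorm g v (2 * q) = partialNorm (g ^ 2) v q * g (partialNorm (g ^ 2) v q) := by
  induction q with
  | zero => simp [partialNorm]
  | succ q ih =>
    rw [Nat.mul_succ, partialNorm_succ, partialNorm_succ, ih, partialNorm_succ, map_mul,
      ← pow_mul, pow_succ' g (2 * q), AlgEquiv.mul_apply]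
    ring

/-- Descending through squares, any other root of unity of 2-power order would produce a square root
of -1. -/
theorem eq_one_or_neg_one_of_pow_two_pow {F : Type*} [Field F] (h : ¬ IsSquare (-1 : F)) {w : F}
    {j : ℕ} (hw : w ^ 2 ^ j = 1) : w = 1 ∨ w = -1 := by
  induction j generalizing w with
  | zero => left; simpa using hw
  | succ j ih =>
    rw [pow_succ', pow_mul] at hw
    rcases ih hw with h1 | h1
    · exact mul_self_eq_one_iff.1 (by rw [← sq, h1])
    · exact (h ⟨w, by rw [← h1, sq]⟩).elim

end TwistedProducts

/-! ### Radicals of the skew-forms. -/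

section SkewForms

variable {K L : Type*} [Field K] [Field L] [Algebra K L]

theorem skewForm_apply (τ : L ≃ₐ[K] L) (b x y : L) :
    skewForm τ b x y = Algebra.trace K L (b * (x * τ y - τ x * y)) := rfl

/-- The linear map `b ↦ f_{b,τ}`. -/
noncomputable def skewMap (τ : L ≃ₐ[K] L) : L →ₗ[K] LinearMap.BilinForm K L where
  toFun := skewForm τ
  map_add' b c := by ext x y; simp [skewForm, add_mul]
  map_smul' c b := by ext x y; simp [skewForm]

theorem skewMap_apply (τ : L ≃ₐ[K] L) (b : L) : skewMap τ b = skewForm τ b := rfl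

theorem skewSpace_eq_range (τ : L ≃ₐ[K] L) : skewSpace τ = LinearMap.range (skewMap τ) := by
  ext f
  exact ⟨fun ⟨b, hb⟩ => ⟨b, hb.symm⟩, fun ⟨b, hb⟩ => ⟨b, hb.symm⟩⟩

theorem skewSpace_eq_map_top (τ : L ≃ₐ[K] L) : skewSpace τ = Submodule.map (skewMap τ) ⊤ := by
  rw [skewSpace_eq_range, LinearMap.range_eq_map]

theorem skewForm_apply_eq_trace_mul (τ : L ≃ₐ[K] L) (b x y : L) :
    skewForm τ b x y = Algebra.trace K L ((τ⁻¹ (b * x) - b * τ x) * y) := by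
  have h : Algebra.trace K L (τ⁻¹ (b * x) * y) = Algebra.trace K L (b * x * τ y) := by
    rw [← Algebra.trace_eq_of_algEquiv τ, map_mul, ← AlgEquiv.mul_apply, mul_inv_cancel,
      AlgEquiv.one_apply]
  rw [sub_mul, map_sub, h, ← map_sub, skewForm_apply]
  congr 1; ring

variable [FiniteDimensional K L] [IsGalois K L]

theorem eq_zero_of_trace_mul_eq_zero {x : L} (h : ∀ y, Algebra.trace K L (x * y) = 0) : x = 0 :=
  (traceForm_nondegenerate K L).1 x h

theorem mem_ker_skewForm {τ : L ≃ₐ[K] L} {b x : L} :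
    x ∈ LinearMap.ker (skewForm τ b) ↔ b * x = τ b * (τ ^ 2) x := by
  have h : x ∈ LinearMap.ker (skewForm τ b) ↔ τ⁻¹ (b * x) - b * τ x = 0 := by
    rw [LinearMap.mem_ker]
    constructor
    · intro h
      refine eq_zero_of_trace_mul_eq_zero (K := K) fun y => ?_
      rw [← skewForm_apply_eq_trace_mul, h, LinearMap.zero_apply]
    · intro h
      ext y
      rw [skewForm_apply_eq_trace_mul, h, zero_mul, map_zero, LinearMap.zero_apply]
  rw [h, sub_eq_zero, ← τ.injective.eq_iff, ← AlgEquiv.mul_apply, mul_inv_cancel,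
    AlgEquiv.one_apply, map_mul τ b, pow_two, AlgEquiv.mul_apply]

/-- As in Hilbert 90, `b / τ(b) = ε y / τ²(y)` for an explicit `y`, so multiplication by `y` carries
the radical onto an eigenspace of `τ²`. -/
theorem finrank_ker_skewForm {τ : L ≃ₐ[K] L} {b : L} (hb : b ≠ 0) {h : ℕ} (hh : Odd h) {ε : K}
    (hε : ε = 1 ∨ ε = -1) (hτ : b ∈ autEigenspace (τ ^ h) ε) :
    Module.finrank K (LinearMap.ker (skewForm τ b)) =
      Module.finrank K (autEigenspace (τ ^ 2) ε) := by
  obtain ⟨q, rfl⟩ := hh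
  have hε2 : ε * ε = 1 := by rcases hε with rfl | rfl <;> simp
  have hε0 : ε ≠ 0 := left_ne_zero_of_mul_eq_one hε2
  -- With `q + 1` factors the product telescopes up to `τ^(2q+2) b = τ(τ^h b) = ε τ(b)`; this is
  -- where `h` odd enters.
  set y := partialNorm (τ ^ 2) b (q + 1) with hy
  have hy0 : y ≠ 0 := partialNorm_ne_zero _ hb _
  have h1 : (τ ^ 2) y * b = y * (ε • τ b) := by
    rw [hy, map_partialNorm_mul, ← pow_mul, mul_add, mul_one, show 2 * q + 2 = (2 * q + 1) + 1 from rfl,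
      pow_succ' τ (2 * q + 1), AlgEquiv.mul_apply, mem_autEigenspace.1 hτ, map_smul]
  have hinj : Function.Injective (LinearMap.mulLeft K y) := mul_right_injective₀ hy0
  have h2 : LinearMap.ker (skewForm τ b) = Submodule.comap
      (LinearEquiv.ofInjectiveEndo (LinearMap.mulLeft K y) hinj : L →ₗ[K] L)
      (autEigenspace (τ ^ 2) ε) := by
    ext x
    rw [mem_ker_skewForm, Submodule.mem_comap, mem_autEigenspace]
    simp only [LinearEquiv.coe_coe, LinearEquiv.coe_ofInjectiveEndo, LinearMap.mulLeft_apply,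
      map_mul]
    rw [← mul_right_inj' (smul_ne_zero hε0 hy0), eq_comm (a := (τ ^ 2) y * _),
      ← mul_right_inj' (b := ε • (y * x)) hb]
    have e1 : b * (ε • (y * x)) = ε • y * (b * x) := by
      rw [Algebra.smul_def, Algebra.smul_def]; ring
    have e2 : b * ((τ ^ 2) y * (τ ^ 2) x) = ε • y * (τ b * (τ ^ 2) x) := by
      rw [← mul_assoc, mul_comm b, h1, Algebra.smul_def, Algebra.smul_def]; ring
    rw [e1, e2]
  rw [h2, Submodule.comap_equiv_eq_map_symm, LinearEquiv.finrank_map_eq]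

/-- For `v = τ(b)/b`, the norm of `v` over `2q` powers of `τ` is `τ^(2q)(b)/b = -1`. A nonzero `x`
in the radical makes half of that norm equal to `±1`, so that the whole would be 1. -/
theorem ker_skewForm_eq_bot {τ : L ≃ₐ[K] L} {b : L} (hb : b ≠ 0) (hL : ¬ IsSquare (-1 : L))
    [CharZero L] {q j : ℕ} (hτ : b ∈ autEigenspace (τ ^ (2 * q)) (-1 : K))
    (h1 : τ ^ (2 * (2 ^ j * q)) = 1) : LinearMap.ker (skewForm τ b) = ⊥ := by
  rw [eq_bot_iff]
  intro x hx
  rw [mem_ker_skewForm] at hx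
  rw [mem_autEigenspace_neg_one] at hτ
  by_contra hx0
  rw [Submodule.mem_bot] at hx0
  have hx2 : (τ ^ 2) x ≠ 0 := (map_ne_zero (τ ^ 2)).2 hx0
  set v := τ b / b with hv
  have hvx : (τ ^ 2) x / x = 1 / v := by
    rw [hv, one_div_div, div_eq_div_iff hx0 ((map_ne_zero τ).2 hb), hx, mul_comm]
  -- Since `1/v = τ²(x)/x`, the norm of `1/v` telescopes to 1 over a full period of `τ²`.
  have hN : partialNorm (τ ^ 2) v (2 ^ j * q) = 1 := by
    have h := partialNorm_map_div_self (τ ^ 2) hx0 (2 ^ j * q)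
    rw [hvx, partialNorm_div, ← pow_mul, h1, AlgEquiv.one_apply, div_self hx0] at h
    have h0 : partialNorm (τ ^ 2) (1 : L) (2 ^ j * q) = 1 :=
      Finset.prod_eq_one fun i _ => map_one _
    rw [h0] at h
    simpa using h
  have hfix : ((τ ^ 2) ^ q) v = v := by
    rw [← pow_mul, hv, map_div₀, ← AlgEquiv.mul_apply, ← pow_succ, pow_succ', AlgEquiv.mul_apply,
      hτ, map_neg, neg_div_neg_eq]
  rw [partialNorm_mul_of_fixed _ hfix] at hN
  have h2 := partialNorm_two_mul τ v q
  rw [hv, partialNorm_map_div_self τ hb, hτ, neg_div, div_self hb, ← hv] at h2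
  rcases eq_one_or_neg_one_of_pow_two_pow hL hN with h | h
  · rw [h, map_one, mul_one] at h2
    exact one_ne_zero (self_eq_neg.1 h2.symm)
  · rw [h, map_neg, map_one, neg_mul_neg, mul_one] at h2
    exact one_ne_zero (self_eq_neg.1 h2.symm)

end SkewForms

/-! ### Constant-rank decompositions of a single `A^τ`. -/

section RankSubspaces

variable {K L : Type*} [Field K] [Field L] [Algebra K L]

theorem autEigenspace_le_pow_mul (g : L ≃ₐ[K] L) (ε : K) (a m : ℕ) :
    autEigenspace (g ^ a) ε ≤ autEigenspace (g ^ (a * m)) (ε ^ m) := fun x hx => by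
  rw [mem_autEigenspace, pow_mul]
  exact pow_apply_of_mem_autEigenspace hx m

theorem autEigenspace_one_eq_top : autEigenspace (1 : L ≃ₐ[K] L) (1 : K) = ⊤ :=
  Submodule.eq_top_iff'.2 fun _ => mem_autEigenspace_one.2 rfl

theorem isDirectSumOf_autEigenspace_of_sq_eq_one [CharZero K] {g : L ≃ₐ[K] L} (hg : g ^ 2 = 1) :
    IsDirectSumOf ⊤ ![autEigenspace g (-1 : K), autEigenspace g (1 : K)] := by
  constructor
  · rw [iSupIndep_pair (i := 0) (j := 1) zero_ne_one (by simp [Fin.forall_fin_two])]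
    exact disjoint_autEigenspace g
  · rw [← autEigenspace_one_eq_top, ← hg, autEigenspace_pow_two]
    set S := ![autEigenspace g (-1 : K), autEigenspace g (1 : K)]
    refine le_antisymm (iSup_le fun j => ?_) (sup_le (le_iSup S 0) (le_iSup S 1))
    fin_cases j
    · exact le_sup_left
    · exact le_sup_right

/-- Iterate `Fix(h²) = {h x = -x} ⊕ Fix(h)` from `Fix(g^(2^β)) = L` down to `Fix(g)`. -/
theorem isDirectSumOf_autEigenspace [CharZero K] {g : L ≃ₐ[K] L} {β : ℕ} (hβ : 1 ≤ β)
    (hg : g ^ 2 ^ β = 1) :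
    IsDirectSumOf ⊤ (Sum.elim (fun j : Fin 2 => autEigenspace g ((![1, -1] : Fin 2 → K) j))
      (fun j : Set.Icc 1 (β - 1) => autEigenspace (g ^ 2 ^ (β - j)) (-1 : K))) := by
  have hle : ∀ a m : ℕ, m ≠ 0 →
      autEigenspace (g ^ 2 ^ a) (-1 : K) ≤ autEigenspace (g ^ 2 ^ (a + m)) 1 := fun a m hm => by
    have := autEigenspace_le_pow_mul g (-1 : K) (2 ^ a) (2 ^ m)
    rwa [← pow_add, (Nat.even_pow.2 ⟨even_two, hm⟩).neg_one_pow] at this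
  have hle1 : ∀ m : ℕ, autEigenspace g (1 : K) ≤ autEigenspace (g ^ 2 ^ m) 1 := fun m => by
    simpa using autEigenspace_le_pow_mul g (1 : K) 1 (2 ^ m)
  have hle2 : ∀ m : ℕ, m ≠ 0 → autEigenspace g (-1 : K) ≤ autEigenspace (g ^ 2 ^ m) 1 :=
    fun m hm => by simpa using hle 0 m hm
  constructor
  -- The rank grows as the power of `g` shrinks. The flag at a -1-eigenspace is the fixed space of
  -- the same power, which contains every summand of larger rank; `Fix(g)` comes last, with flag
  -- zero.
  · refine iSupIndep_of_injective_rank (Sum.elim ![β + 1, β] (fun j => (j : ℕ))) ?_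
      (Sum.elim ![⊥, autEigenspace g (1 : K)]
        (fun j : Set.Icc 1 (β - 1) => autEigenspace (g ^ 2 ^ (β - j)) (1 : K))) ?_ ?_
    · rintro (i | ⟨i, hi⟩) (j | ⟨j, hj⟩) h
      · fin_cases i <;> fin_cases j <;> simp at h ⊢
      · rw [Set.mem_Icc] at hj
        fin_cases i <;> simp at h <;> omega
      · rw [Set.mem_Icc] at hi
        fin_cases j <;> simp at h <;> omega
      · simpa using h
    · rintro (j | j)
      · fin_cases j
        · exact disjoint_bot_right
        · exact disjoint_autEigenspace g
      · exact disjoint_autEigenspace _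
    · rintro (i | ⟨i, hi⟩) (j | ⟨j, hj⟩) h
      · fin_cases i <;> fin_cases j <;> simp at h ⊢
      · rw [Set.mem_Icc] at hj
        fin_cases i <;> simp at h <;> omega
      · rw [Set.mem_Icc] at hi
        fin_cases j
        · exact hle1 _
        · exact hle2 _ (by simp; omega)
      · rw [Set.mem_Icc] at hi hj
        have hij : i < j := h
        have := hle (β - j) (j - i) (by omega)
        rwa [show β - j + (j - i) = β - i by omega] at this
  · set S := Sum.elim (fun j : Fin 2 => autEigenspace g ((![1, -1] : Fin 2 → K) j))
      (fun j : Set.Icc 1 (β - 1) => autEigenspace (g ^ 2 ^ (β - j)) (-1 : K)) with hS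
    have key : ∀ c ≤ β, autEigenspace (g ^ 2 ^ c) (1 : K) ≤ ⨆ j, S j := by
      intro c hc
      induction c with
      | zero => rw [pow_zero, pow_one]; exact le_iSup S (Sum.inl 0)
      | succ c ih =>
        rw [pow_succ, pow_mul, autEigenspace_pow_two]
        refine sup_le ?_ (ih (by omega))
        rcases Nat.eq_zero_or_pos c with rfl | h0
        · rw [pow_zero, pow_one]; exact le_iSup S (Sum.inl 1)
        · have := le_iSup S (Sum.inr ⟨β - c, Set.mem_Icc.2 (by omega)⟩)
          rw [hS, Sum.elim_inr] at this
          rwa [show β - (β - c) = c by omega] at this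
    rw [eq_top_iff, ← autEigenspace_one_eq_top, ← hg]
    exact key β le_rfl

variable [FiniteDimensional K L]

theorem finrank_range_skewForm (τ : L ≃ₐ[K] L) (b : L) :
    Module.finrank K (LinearMap.range (skewForm τ b)) =
      Module.finrank K L - Module.finrank K (LinearMap.ker (skewForm τ b)) := by
  rw [← LinearMap.finrank_range_add_finrank_ker (skewForm τ b), Nat.add_sub_cancel]

variable [IsGalois K L]

theorem skewMap_injective {τ : L ≃ₐ[K] L} (hτ : τ ^ 2 ≠ 1) : Function.Injective (skewMap τ) := by
  refine (LinearMap.ker_eq_bot (M := L) (M₂ := LinearMap.BilinForm K L)).1 ?_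
  rw [eq_bot_iff]
  intro b hb
  rw [LinearMap.mem_ker, skewMap_apply] at hb
  have h : ∀ x, b * x = τ b * (τ ^ 2) x := fun x => by
    rw [← mem_ker_skewForm, hb, LinearMap.ker_zero]; trivial
  by_contra hb0
  have h1 := h 1
  rw [map_one, mul_one, mul_one] at h1
  refine hτ (AlgEquiv.ext fun x => ?_)
  have h2 := h x
  rw [← h1] at h2
  exact (mul_left_cancel₀ hb0 h2).symm

theorem isRankSubspace_map_skewMap {τ : L ≃ₐ[K] L} (hτ : τ ^ 2 ≠ 1) {W : Submodule K L} {m : ℕ}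
    (hker : ∀ b ∈ W, b ≠ 0 → Module.finrank K (LinearMap.ker (skewForm τ b)) = m) :
    IsRankSubspace (W.map (skewMap τ)) (Module.finrank K L - m) (Module.finrank K W) := by
  constructor
  · rintro _ ⟨b, hb, rfl⟩ hf
    have hb0 : b ≠ 0 := fun h => hf (by rw [h, map_zero])
    rw [skewMap_apply, finrank_range_skewForm, hker b hb hb0]
  · exact (Submodule.equivMapOfInjective (skewMap τ) (skewMap_injective hτ) W).finrank_eq.symm

/-- Here the radical equation is `b x = τ(b) x`: the form is zero if `τ` fixes `b` and nondegenerate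
otherwise. Thus `b ↦ f_{b,τ}` has kernel `Fix(τ)`, of dimension half that of `L`. -/
theorem isRankSubspace_skewSpace_of_sq_eq_one [CharZero K] {τ : L ≃ₐ[K] L} (hτ : orderOf τ = 2) :
    IsRankSubspace (skewSpace τ) (Module.finrank K L) (Module.finrank K L / 2) := by
  have h1 : τ ^ 2 = 1 := hτ ▸ pow_orderOf_eq_one τ
  have hker : ∀ b, τ b = b → skewForm τ b = 0 := fun b hb => by
    rw [← LinearMap.ker_eq_top, Submodule.eq_top_iff']
    intro x
    rw [mem_ker_skewForm, h1, hb, AlgEquiv.one_apply]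
  constructor
  · rintro _ ⟨b, rfl⟩ hf
    rw [finrank_range_skewForm]
    have : LinearMap.ker (skewForm τ b) = ⊥ := by
      rw [eq_bot_iff]
      intro x hx
      rw [mem_ker_skewForm, h1, AlgEquiv.one_apply] at hx
      by_contra hx0
      exact hf (hker b (mul_right_cancel₀ hx0 hx).symm)
    rw [this, finrank_bot, Nat.sub_zero]
  · have h2 : LinearMap.ker (skewMap τ) = autEigenspace τ (1 : K) := by
      ext b
      rw [LinearMap.mem_ker, skewMap_apply, mem_autEigenspace_one]
      refine ⟨fun h => ?_, hker b⟩
      have h3 : (1 : L) ∈ LinearMap.ker (skewForm τ b) := by rw [h, LinearMap.ker_zero]; trivial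
      rw [mem_ker_skewForm, map_one, mul_one, mul_one] at h3
      exact h3.symm
    have h3 := LinearMap.finrank_range_add_finrank_ker (K := K) (V := L)
      (V₂ := LinearMap.BilinForm K L) (skewMap τ)
    have h4 := finrank_autEigenspace_one_mul τ
    rw [h2] at h3
    rw [hτ] at h4
    rw [skewSpace_eq_range]
    omega

theorem isRankSubspace_map_autEigenspace_of_odd {τ : L ≃ₐ[K] L} (hτ : τ ^ 2 ≠ 1) {ε : K}
    (hε : ε = 1 ∨ ε = -1) {h : ℕ} (hh : Odd h) :
    IsRankSubspace ((autEigenspace (τ ^ h) ε).map (skewMap τ))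
      (Module.finrank K L - Module.finrank K (autEigenspace (τ ^ 2) ε))
      (Module.finrank K (autEigenspace (τ ^ h) ε)) :=
  isRankSubspace_map_skewMap hτ fun _ hb hb0 => finrank_ker_skewForm hb0 hh hε hb

theorem orderOf_sq_of_odd {G : Type*} [Group G] {τ : G} (hτ : Odd (orderOf τ)) :
    orderOf (τ ^ 2) = orderOf τ := by
  rw [orderOf_pow' τ two_ne_zero, hτ.coprime_two_right.gcd_eq_one, Nat.div_one]

theorem orderOf_pow_of_eq_mul {G : Type*} [Group G] {τ : G} {a m : ℕ} (ha : 0 < a)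
    (h : orderOf τ = a * m) : orderOf (τ ^ a) = m := by
  rw [orderOf_pow' τ ha.ne', h, Nat.gcd_mul_right_left, Nat.mul_div_cancel_left _ ha]

theorem isRankSubspace_skewSpace_of_odd {τ : L ≃ₐ[K] L} (hτ : Odd (orderOf τ))
    (h1 : orderOf τ ≠ 1) :
    IsRankSubspace (skewSpace τ) (Module.finrank K L - Module.finrank K L / orderOf τ)
      (Module.finrank K L) := by
  have h2 : τ ^ 2 ≠ 1 := fun h => by
    rw [← orderOf_eq_one_iff, orderOf_sq_of_odd hτ] at h
    exact h1 h
  have h3 := isRankSubspace_map_autEigenspace_of_odd h2 (ε := (1 : K)) (Or.inl rfl) hτ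
  rwa [finrank_autEigenspace_one, orderOf_sq_of_odd hτ, pow_orderOf_eq_one,
    autEigenspace_one_eq_top, ← skewSpace_eq_map_top, finrank_top] at h3

/-- The summands of `A^τ` when `ord τ ≡ 2 mod 4`, for `ε = -1` and `ε = 1`. -/
noncomputable def halfOrderSummand (τ : L ≃ₐ[K] L) (ε : K) :
    Submodule K (LinearMap.BilinForm K L) :=
  (autEigenspace (τ ^ (orderOf τ / 2)) ε).map (skewMap τ)

/-- The summands `V_1, V_2` of `A^τ` when `4 ∣ ord τ`. -/
noncomputable def oddPartSummand (τ : L ≃ₐ[K] L) (j : Fin 2) :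
    Submodule K (LinearMap.BilinForm K L) :=
  (autEigenspace (τ ^ (orderOf τ / 2 ^ (orderOf τ).factorization 2)) ((![1, -1] : Fin 2 → K) j)).map
    (skewMap τ)

/-- The summands `E_j` of `A^τ` when `4 ∣ ord τ`. -/
noncomputable def twoPartSummand (τ : L ≃ₐ[K] L) (j : ℕ) :
    Submodule K (LinearMap.BilinForm K L) :=
  (autEigenspace (τ ^ (orderOf τ / 2 ^ j)) (-1 : K)).map (skewMap τ)

theorem halfOrderSummand_spec [CharZero K] {τ : L ≃ₐ[K] L} (h4 : orderOf τ % 4 = 2)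
    (h2 : orderOf τ ≠ 2) :
    IsDirectSumOf (skewSpace τ) ![halfOrderSummand τ (-1 : K), halfOrderSummand τ (1 : K)] ∧
    IsRankSubspace (halfOrderSummand τ (-1 : K)) (Module.finrank K L) (Module.finrank K L / 2) ∧
    IsRankSubspace (halfOrderSummand τ (1 : K))
      (Module.finrank K L - 2 * Module.finrank K L / orderOf τ) (Module.finrank K L / 2) := by
  obtain ⟨h, ho⟩ : ∃ h, orderOf τ = 2 * h := ⟨orderOf τ / 2, by omega⟩
  have hodd : Odd h := by rw [Nat.odd_iff]; omega
  have hh : orderOf τ / 2 = h := by omega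
  have hτ2 : orderOf (τ ^ 2) = h := orderOf_pow_of_eq_mul two_pos ho
  have hτh : orderOf (τ ^ h) = 2 := orderOf_pow_of_eq_mul hodd.pos (by rw [ho, mul_comm])
  have hτ : τ ^ 2 ≠ 1 := fun h => by
    rw [← orderOf_eq_one_iff, hτ2] at h
    omega
  refine ⟨?_, ?_, ?_⟩
  · have := (isDirectSumOf_autEigenspace_of_sq_eq_one (K := K) (g := τ ^ h)
      (by rw [← hτh, pow_orderOf_eq_one])).map (N := LinearMap.BilinForm K L) (skewMap τ)
      (skewMap_injective hτ)
    rw [skewSpace_eq_map_top]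
    refine (congrArg (IsDirectSumOf _) (funext fun j => ?_)).mpr this
    fin_cases j <;> simp [halfOrderSummand, hh]
  · have := isRankSubspace_map_autEigenspace_of_odd hτ (ε := (-1 : K)) (Or.inr rfl) hodd
    rwa [autEigenspace_neg_one_eq_bot (τ ^ 2) (by rwa [hτ2]), finrank_bot, Nat.sub_zero,
      finrank_autEigenspace_neg_one _ (by rw [hτh]; exact even_two), hτh, ← hh] at this
  · have := isRankSubspace_map_autEigenspace_of_odd hτ (ε := (1 : K)) (Or.inl rfl) hodd
    rwa [finrank_autEigenspace_one, finrank_autEigenspace_one, hτ2, hτh,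
      ← Nat.mul_div_mul_left (Module.finrank K L) h two_pos, ← ho, ← hh] at this

theorem twoPartSummand_spec [CharZero K] (hL : ¬ IsSquare (-1 : L)) {τ : L ≃ₐ[K] L} {β k : ℕ}
    (hβ : 2 ≤ β) (hk : Odd k) (ho : orderOf τ = 2 ^ β * k) :
    IsDirectSumOf (skewSpace τ)
      (Sum.elim (oddPartSummand τ) (fun j : Set.Icc 1 (β - 1) => twoPartSummand τ (j : ℕ))) ∧
    (∀ j ∈ Set.Icc 1 (β - 1), IsRankSubspace (twoPartSummand τ j) (Module.finrank K L)
      (Module.finrank K L / 2 ^ j)) ∧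
    (∀ j : Fin 2, IsRankSubspace (oddPartSummand τ j)
      (Module.finrank K L - 2 * Module.finrank K L / orderOf τ)
      (k * Module.finrank K L / orderOf τ)) := by
  have : CharZero L := charZero_of_injective_algebraMap (algebraMap K L).injective
  have hfac : (orderOf τ).factorization 2 = β := by
    rw [ho, Nat.factorization_mul (by positivity) hk.pos.ne', Nat.factorization_pow]
    simp [Nat.prime_two.factorization,
      Nat.factorization_eq_zero_of_not_dvd hk.not_two_dvd_nat]
  have hodd : orderOf τ / 2 ^ (orderOf τ).factorization 2 = k := by
    rw [hfac, ho, Nat.mul_div_cancel_left _ (by positivity)]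
  have htwo : ∀ j ≤ β, orderOf τ / 2 ^ j = k * 2 ^ (β - j) := fun j hj => by
    rw [ho, ← pow_mul_pow_sub 2 hj, mul_assoc, Nat.mul_div_cancel_left _ (by positivity),
      mul_comm]
  obtain ⟨γ, rfl⟩ : ∃ γ, β = γ + 1 := ⟨β - 1, by omega⟩
  have hτ2 : orderOf (τ ^ 2) = 2 ^ γ * k := orderOf_pow_of_eq_mul two_pos (by rw [ho]; ring)
  have hτk : orderOf (τ ^ k) = 2 ^ (γ + 1) := orderOf_pow_of_eq_mul hk.pos (by rw [ho, mul_comm])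
  have heven : Even (orderOf (τ ^ 2)) := by
    rw [hτ2]; exact (Nat.even_pow.2 ⟨even_two, by omega⟩).mul_right k
  have hτ : τ ^ 2 ≠ 1 := fun h => by
    rw [h, orderOf_one] at heven
    exact absurd heven (by decide)
  refine ⟨?_, fun j hj => ?_, fun j => ?_⟩
  · have := (isDirectSumOf_autEigenspace (K := K) (g := τ ^ k) (β := γ + 1) (by omega)
      (by rw [← hτk, pow_orderOf_eq_one])).map (N := LinearMap.BilinForm K L) (skewMap τ)
      (skewMap_injective hτ)
    rw [skewSpace_eq_map_top]
    refine (congrArg (IsDirectSumOf _) (funext fun j => ?_)).mpr this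
    rcases j with j | ⟨j, hj⟩
    · simp [oddPartSummand, hodd]
    · rw [Set.mem_Icc] at hj
      simp only [Sum.elim_inr, twoPartSummand]
      rw [htwo j (by omega), pow_mul]
  · rw [Set.mem_Icc] at hj
    have hj' := htwo j (by omega)
    -- The exponent is even exactly because `j` stops at `β - 1`; this is what `ker_skewForm_eq_bot`
    -- requires.
    obtain ⟨q, hq⟩ : ∃ q, orderOf τ / 2 ^ j = 2 * q :=
      ⟨k * 2 ^ (γ - j), by rw [hj', show γ + 1 - j = (γ - j) + 1 by omega]; ring⟩
    have hmul : 2 ^ j * (orderOf τ / 2 ^ j) = orderOf τ :=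
      Nat.mul_div_cancel' (Dvd.dvd.trans (pow_dvd_pow 2 (by omega)) (Dvd.intro _ ho.symm))
    have hpos : 0 < orderOf τ / 2 ^ j := by rw [hj']; exact Nat.mul_pos hk.pos (by positivity)
    have hord : orderOf (τ ^ (orderOf τ / 2 ^ j)) = 2 ^ j :=
      orderOf_pow_of_eq_mul hpos (by rw [mul_comm, hmul])
    have := isRankSubspace_map_skewMap hτ (m := 0)
      (W := autEigenspace (τ ^ (orderOf τ / 2 ^ j)) (-1 : K)) (fun b hb hb0 => by
        rw [hq] at hb
        rw [ker_skewForm_eq_bot hb0 hL hb (j := j) (by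
          rw [mul_left_comm, ← hq, hmul, pow_orderOf_eq_one]), finrank_bot])
    rwa [Nat.sub_zero, finrank_autEigenspace_neg_one _ (by
      rw [hord]; exact Nat.even_pow.2 ⟨even_two, by omega⟩), hord] at this
  · have h2 : ∀ ε : K, ε = 1 ∨ ε = -1 → ∀ g : L ≃ₐ[K] L, Even (orderOf g) →
        Module.finrank K (autEigenspace g ε) = Module.finrank K L / orderOf g := by
      rintro ε (rfl | rfl) g hg
      · exact finrank_autEigenspace_one g
      · exact finrank_autEigenspace_neg_one g hg
    have hε : (![1, -1] : Fin 2 → K) j = 1 ∨ (![1, -1] : Fin 2 → K) j = -1 := by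
      fin_cases j <;> simp
    have := isRankSubspace_map_autEigenspace_of_odd hτ hε hk
    rw [h2 _ hε _ heven, h2 _ hε _ (by rw [hτk]; exact Nat.even_pow.2 ⟨even_two, by omega⟩)] at this
    rw [oddPartSummand, hodd]
    have e1 : 2 * Module.finrank K L / orderOf τ = Module.finrank K L / orderOf (τ ^ 2) := by
      rw [ho, hτ2, ← Nat.mul_div_mul_left (Module.finrank K L) (2 ^ γ * k) two_pos]
      congr 1; ring
    have e2 : k * Module.finrank K L / orderOf τ = Module.finrank K L / orderOf (τ ^ k) := by
      rw [hτk, ho, mul_comm (2 ^ (γ + 1)), Nat.mul_div_mul_left _ _ hk.pos]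
    rwa [e1, e2]

end RankSubspaces

/-! ### Alternating forms as the sum of the spaces `A^g`. -/

section AlternatingForms

variable {K L : Type*} [Field K] [Field L] [Algebra K L] [FiniteDimensional K L]

/-- The bilinear form `(x, y) ↦ Tr (x * ∑ g, c g * g y)`. -/
noncomputable def coeffForm (c : (L ≃ₐ[K] L) → L) : LinearMap.BilinForm K L :=
  (Algebra.traceForm K L).compl₂ (∑ g, c g • g.toLinearMap)

theorem coeffForm_apply (c : (L ≃ₐ[K] L) → L) (x y : L) :
    coeffForm c x y = Algebra.trace K L (x * ∑ g, c g * g y) := by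
  rw [coeffForm, LinearMap.compl₂_apply, Algebra.traceForm_apply, LinearMap.sum_apply]
  rfl

variable (K L) in
/-- `coeffForm` as a linear map. -/
noncomputable def coeffMap : ((L ≃ₐ[K] L) → L) →ₗ[K] LinearMap.BilinForm K L where
  toFun := coeffForm
  map_add' c d := by
    ext x y
    simp only [LinearMap.add_apply, coeffForm_apply, Pi.add_apply, add_mul, Finset.sum_add_distrib,
      mul_add, map_add]
  map_smul' a c := by
    ext x y
    simp only [LinearMap.smul_apply, coeffForm_apply, Pi.smul_apply, smul_mul_assoc,
      ← Finset.smul_sum, mul_smul_comm, map_smul, RingHom.id_apply]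

theorem coeffMap_apply (c : (L ≃ₐ[K] L) → L) (x y : L) :
    coeffMap K L c x y = Algebra.trace K L (x * ∑ g, c g * g y) := coeffForm_apply c x y

theorem skewForm_eq_coeffMap [DecidableEq (L ≃ₐ[K] L)] (τ : L ≃ₐ[K] L) (b : L) :
    skewForm τ b = coeffMap K L (Pi.single τ b - Pi.single τ⁻¹ (τ⁻¹ b)) := by
  have h : ∀ (g : L ≃ₐ[K] L) (c y : L),
      ∑ f, (Pi.single g c : (L ≃ₐ[K] L) → L) f * f y = c * g y := fun g c y => by
    rw [Finset.sum_eq_single g (fun f _ hf => by rw [Pi.single_eq_of_ne hf, zero_mul])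
      (fun h => (h (Finset.mem_univ g)).elim), Pi.single_eq_same]
  ext x y
  rw [map_sub, LinearMap.sub_apply, LinearMap.sub_apply, coeffMap_apply, coeffMap_apply, h, h]
  have h2 : Algebra.trace K L (x * (τ⁻¹ b * τ⁻¹ y)) = Algebra.trace K L (τ x * (b * y)) := by
    rw [← Algebra.trace_eq_of_algEquiv τ, map_mul τ, map_mul τ, ← AlgEquiv.mul_apply,
      ← AlgEquiv.mul_apply, mul_inv_cancel, AlgEquiv.one_apply, AlgEquiv.one_apply]
  rw [h2, ← map_sub, skewForm_apply]
  congr 1; ring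

omit [FiniteDimensional K L] in
theorem skewSpace_le_altForms (τ : L ≃ₐ[K] L) : skewSpace τ ≤ altForms K L := by
  rintro _ ⟨b, rfl⟩ x
  rw [skewForm_apply, mul_comm x, sub_self, mul_zero, map_zero]

theorem skewSpace_inv_le (τ : L ≃ₐ[K] L) : skewSpace τ⁻¹ ≤ skewSpace τ := by
  classical
  rintro _ ⟨b, rfl⟩
  refine ⟨-τ b, ?_⟩
  rw [skewForm_eq_coeffMap, skewForm_eq_coeffMap, inv_inv]
  congr 1
  rw [map_neg, ← AlgEquiv.mul_apply τ⁻¹, inv_mul_cancel, AlgEquiv.one_apply, Pi.single_neg,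
    Pi.single_neg]
  abel

omit [FiniteDimensional K L] in
theorem skewSpace_one : skewSpace (1 : L ≃ₐ[K] L) = ⊥ := by
  rw [eq_bot_iff]
  rintro _ ⟨b, rfl⟩
  rw [Submodule.mem_bot]
  ext x y
  simp [skewForm_apply]

variable [IsGalois K L]

/-- Dedekind's independence of automorphisms over `L`, after the trace form is removed by
nondegeneracy. -/
theorem coeffMap_injective : Function.Injective (coeffMap K L) := by
  refine (LinearMap.ker_eq_bot (M := (L ≃ₐ[K] L) → L) (M₂ := LinearMap.BilinForm K L)).1 ?_
  rw [eq_bot_iff]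
  intro c hc
  rw [LinearMap.mem_ker] at hc
  have h : ∑ g, c g • (g : L →ₐ[K] L).toLinearMap = 0 := by
    ext y
    rw [LinearMap.zero_apply]
    refine eq_zero_of_trace_mul_eq_zero (K := K) fun x => ?_
    have := coeffMap_apply c x y
    rw [hc, LinearMap.zero_apply, LinearMap.zero_apply] at this
    rw [this, mul_comm]
    simp
  have hli : LinearIndependent L fun g : L ≃ₐ[K] L => (g : L →ₐ[K] L).toLinearMap :=
    (linearIndependent_toLinearMap K L L).comp (fun g : L ≃ₐ[K] L => (g : L →ₐ[K] L))
      AlgEquiv.coe_toAlgHom_injective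
  rw [Submodule.mem_bot]
  funext g
  exact Fintype.linearIndependent_iff.1 hli c h g

theorem coeffMap_surjective : Function.Surjective (coeffMap K L) := by
  refine (LinearMap.injective_iff_surjective_of_finrank_eq_finrank (V := (L ≃ₐ[K] L) → L)
    (V₂ := LinearMap.BilinForm K L) ?_).1 coeffMap_injective
  rw [Module.finrank_pi_fintype, Finset.sum_const, Finset.card_univ, ← Nat.card_eq_fintype_card,
    IsGalois.card_aut_eq_finrank, smul_eq_mul, Module.finrank_linearMap, Module.finrank_linearMap,
    Module.finrank_self, mul_one]

theorem altForms_eq_iSup_skewSpace [CharZero K] :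
    altForms K L = ⨆ g : L ≃ₐ[K] L, skewSpace g := by
  refine le_antisymm (fun f hf => ?_) (iSup_le skewSpace_le_altForms)
  have halt : LinearMap.IsAlt f := hf
  obtain ⟨c, rfl⟩ := coeffMap_surjective f
  -- For alternating `f`, `2 f(x, y) = f(x, y) - f(y, x)`, which antisymmetrizes the expansion term
  -- by term.
  have h : (2 : K) • coeffMap K L c = ∑ g, skewForm g (c g) := by
    ext x y
    have h1 : coeffMap K L c x y = - coeffMap K L c y x := (neg_eq_iff_eq_neg.1 (halt.neg x y))
    rw [two_smul, LinearMap.add_apply, LinearMap.add_apply]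
    nth_rewrite 2 [h1]
    rw [← sub_eq_add_neg, coeffMap_apply, coeffMap_apply, ← map_sub, Finset.mul_sum, Finset.mul_sum,
      ← Finset.sum_sub_distrib, map_sum, LinearMap.sum_apply, LinearMap.sum_apply]
    refine Finset.sum_congr rfl fun g _ => ?_
    rw [skewForm_apply]
    congr 1; ring
  rw [← inv_smul_smul₀ (two_ne_zero (α := K)) (coeffMap K L c), h]
  exact Submodule.smul_mem _ _ (Submodule.sum_mem _ fun g _ =>
    (le_iSup (fun g : L ≃ₐ[K] L => skewSpace g) g) ⟨c g, rfl⟩)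

theorem isDirectSumOf_altForms [CharZero K] {σ : L ≃ₐ[K] L} (hσ : ∀ τ, τ ∈ Subgroup.zpowers σ)
    {m : ℕ} (ho : orderOf σ = 2 * m) :
    IsDirectSumOf (altForms K L) (fun i : Set.Icc 1 m => skewSpace (σ ^ (i : ℕ))) := by
  classical
  constructor
  · refine (iSupIndep_iff_finsetSum_eq_zero_imp_eq_zero (N := LinearMap.BilinForm K L) _).2 ?_
    intro s f hf h0 i hi
    choose! b hb using hf
    set d : Set.Icc 1 m → (L ≃ₐ[K] L) → L := fun j =>
      Pi.single (σ ^ (j : ℕ)) (b j) - Pi.single (σ ^ (j : ℕ))⁻¹ ((σ ^ (j : ℕ))⁻¹ (b j)) with hd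
    have h1 : ∀ j ∈ s, f j = coeffMap K L (d j) := fun j hj => by
      rw [hb j hj, skewForm_eq_coeffMap]
    have h2 : ∑ j ∈ s, d j = 0 := coeffMap_injective (by
      rw [map_sum, map_zero, ← h0]
      exact Finset.sum_congr rfl fun j hj => (h1 j hj).symm)
    have h3 : d i (σ ^ (i : ℕ)) = 0 := by
      have h4 := congrFun h2 (σ ^ (i : ℕ))
      rw [Finset.sum_apply, Finset.sum_eq_single i _ (fun h => (h hi).elim)] at h4
      · exact h4
      intro j _ hji
      have hi' := i.2
      have hj' := j.2
      rw [Set.mem_Icc] at hi' hj'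
      have hne : (j : ℕ) ≠ i := fun h => hji (Subtype.ext h)
      have e1 : σ ^ (i : ℕ) ≠ σ ^ (j : ℕ) := fun h =>
        hne (pow_injOn_Iio_orderOf (by rw [Set.mem_Iio]; omega) (by rw [Set.mem_Iio]; omega) h.symm)
      have e2 : σ ^ (i : ℕ) ≠ (σ ^ (j : ℕ))⁻¹ := fun h => by
        -- Here `i + j` would be a multiple of `2m`, but distinct `i, j ≤ m` have sum less than
        -- `2m`.
        rw [eq_inv_iff_mul_eq_one, ← pow_add] at h
        have := Nat.le_of_dvd (by omega) (orderOf_dvd_of_pow_eq_one h)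
        omega
      simp only [hd, Pi.sub_apply]
      rw [Pi.single_eq_of_ne e1, Pi.single_eq_of_ne e2, sub_zero]
    -- The target is `d i = 0` and not `b i = 0`: for `i = m` the two coefficients sit at the same
    -- involution and vanish as soon as it fixes `b i`.
    have h5 : d i = 0 := by
      simp only [hd, Pi.sub_apply] at h3 ⊢
      rw [Pi.single_eq_same] at h3
      by_cases h : σ ^ (i : ℕ) = (σ ^ (i : ℕ))⁻¹
      · rw [← h] at h3 ⊢
        rw [Pi.single_eq_same, sub_eq_zero] at h3
        rw [← h3, sub_self]
      · rw [Pi.single_eq_of_ne h, sub_zero] at h3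
        rw [h3, map_zero, Pi.single_zero, Pi.single_zero, sub_self]
    rw [h1 i hi, h5, map_zero]
  · rw [altForms_eq_iSup_skewSpace]
    refine le_antisymm (iSup_le fun i => le_iSup (fun g : L ≃ₐ[K] L => skewSpace g) _)
      (iSup_le fun g => ?_)
    obtain ⟨j, hj, rfl⟩ : ∃ j < 2 * m, σ ^ j = g := by
      obtain ⟨j, hj⟩ := (isOfFinOrder_of_finite σ).mem_powers_iff_mem_zpowers.2 (hσ g)
      exact ⟨j % orderOf σ, ho ▸ Nat.mod_lt _ (orderOf_pos σ), by rw [pow_mod_orderOf]; exact hj⟩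
    rcases Nat.eq_zero_or_pos j with rfl | h0
    · rw [pow_zero, skewSpace_one]; exact bot_le
    rcases le_or_gt j m with hjm | hjm
    · exact le_iSup (fun i : Set.Icc 1 m => skewSpace (σ ^ (i : ℕ))) ⟨j, h0, hjm⟩
    · have h1 : σ ^ j = (σ ^ (2 * m - j))⁻¹ := by
        rw [eq_inv_iff_mul_eq_one, ← pow_add, Nat.add_sub_cancel' hj.le, ← ho, pow_orderOf_eq_one]
      rw [h1]
      exact (skewSpace_inv_le _).trans (le_iSup (fun i : Set.Icc 1 m => skewSpace (σ ^ (i : ℕ)))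
        ⟨2 * m - j, by omega, by omega⟩)

end AlternatingForms

/-! ### From the blocks `A^i` to the labelled family of summands. -/

section Labels

/-- The exponent `i` to which a summand label belongs. -/
def SummandLabel.index {G : Type*} [Group G] {n : ℕ} {σ : G} : SummandLabel n σ → ℕ
  | .invol => n / 2
  | .twoU i _ _ => i
  | .twoV i _ _ => i
  | .odd i _ _ => i
  | .fourV i _ _ _ => i
  | .fourE i _ _ _ _ => i

theorem SummandLabel.index_mem {G : Type*} [Group G] {n : ℕ} {σ : G} (hn : 2 ≤ n)
    (l : SummandLabel n σ) : l.index ∈ Set.Icc 1 (n / 2) := by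
  rw [Set.mem_Icc]
  cases l <;> simp only [SummandLabel.index] <;> omega

/-- The parametrization of each fibre need only be onto, since independence descends along a
surjection of index types. -/
theorem IsDirectSumOf.refine_of_range {K M κ ι : Type*} [Field K] [AddCommGroup M] [Module K M]
    {A : Submodule K M} {B : κ → Submodule K M} (hB : IsDirectSumOf A B) {W : ι → Submodule K M}
    (p : ι → κ) (h : ∀ k, ∃ (J : Type) (g : J → ι), (∀ i, p i = k ↔ i ∈ Set.range g) ∧
      IsDirectSumOf (B k) (W ∘ g)) : IsDirectSumOf A W := by
  refine hB.refine p (J := fun k => {i // p i = k}) (W' := fun k i => W i) (fun k => ?_)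
    (fun k => Subtype.val) (fun k => Subtype.val_injective) (fun i k => by simp) fun _ _ => rfl
  obtain ⟨J, g, hg, h1, h2⟩ := h k
  let f : J → {i // p i = k} := fun j => ⟨g j, (hg _).2 ⟨j, rfl⟩⟩
  have hf : Function.Surjective f := fun ⟨i, hi⟩ => by
    obtain ⟨j, rfl⟩ := (hg i).1 hi
    exact ⟨j, rfl⟩
  refine ⟨iSupIndep.comp' (f := f) h1 hf, ?_⟩
  rw [← h2]
  exact (hf.iSup_comp (fun i : {i // p i = k} => W i)).symm

theorem isDirectSumOf_unit {K M : Type*} [Field K] [AddCommMonoid M] [Module K M]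
    (A : Submodule K M) : IsDirectSumOf A (fun _ : Unit => A) :=
  ⟨iSupIndep_subsingleton _, ciSup_const⟩

variable {K L : Type*} [Field K] [Field L] [Algebra K L]

theorem isDirectSumOf_summand {n m : ℕ} (hm : 0 < m) (hn : n = 2 * m) {σ : L ≃ₐ[K] L}
    (ho : orderOf σ = n)
    (hA : IsDirectSumOf (altForms K L) (fun i : Set.Icc 1 m => skewSpace (σ ^ (i : ℕ))))
    {U V : ℕ → Submodule K (LinearMap.BilinForm K L)}
    {V' : ℕ → Fin 2 → Submodule K (LinearMap.BilinForm K L)}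
    {E : ℕ → ℕ → Submodule K (LinearMap.BilinForm K L)}
    (h4 : ∀ i, orderOf (σ ^ i) % 4 = 0 → IsDirectSumOf (skewSpace (σ ^ i)) (Sum.elim (V' i)
      (fun j : Set.Icc 1 (padicValNat 2 (orderOf (σ ^ i)) - 1) => E i (j : ℕ))))
    (h2 : ∀ i, orderOf (σ ^ i) % 4 = 2 → orderOf (σ ^ i) ≠ 2 →
      IsDirectSumOf (skewSpace (σ ^ i)) ![U i, V i]) :
    IsDirectSumOf (altForms K L) (summand n σ U V V' E) := by
  have hnm : n / 2 = m := by omega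
  refine IsDirectSumOf.refine_of_range (M := LinearMap.BilinForm K L) hA
    (fun l => ⟨l.index, hnm ▸ l.index_mem (by omega)⟩) ?_
  rintro ⟨i, hi⟩
  simp only [Subtype.mk.injEq]
  rw [Set.mem_Icc] at hi
  rcases eq_or_lt_of_le hi.2 with rfl | hlt
  · refine ⟨Unit, fun _ => .invol, fun l => ?_, ?_⟩
    · constructor
      · intro hl
        cases l <;> simp only [SummandLabel.index] at hl <;> first | exact ⟨(), rfl⟩ | omega
      · rintro ⟨_, rfl⟩; exact hnm
    · refine (congrArg (IsDirectSumOf _) (funext fun _ => ?_)).mpr (isDirectSumOf_unit _)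
      simp only [Function.comp_apply, summand, hnm]
  have hi' : 1 ≤ i ∧ i < n / 2 := ⟨hi.1, by omega⟩
  -- Order 2 would make `n` divide `2i`, while `0 < 2i < n`.
  have hne : orderOf (σ ^ i) ≠ 2 := fun h => by
    have h1 : σ ^ (i * 2) = 1 := by rw [pow_mul, ← h, pow_orderOf_eq_one]
    have := Nat.le_of_dvd (by omega) (orderOf_dvd_of_pow_eq_one h1)
    omega
  have hcases : orderOf (σ ^ i) % 2 = 1 ∨ orderOf (σ ^ i) % 4 = 2 ∨ orderOf (σ ^ i) % 4 = 0 := by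
    omega
  rcases hcases with h | h | h
  · refine ⟨Unit, fun _ => .odd i hi' h, fun l => ?_, isDirectSumOf_unit _⟩
    constructor
    · intro hl
      cases l <;> simp only [SummandLabel.index] at hl <;> (try subst hl) <;>
        first | exact ⟨(), rfl⟩ | omega
    · rintro ⟨_, rfl⟩; rfl
  · refine ⟨Fin 2, ![.twoU i hi' ⟨h, hne⟩, .twoV i hi' ⟨h, hne⟩], fun l => ?_, ?_⟩
    · constructor
      · intro hl
        cases l <;> simp only [SummandLabel.index] at hl <;> (try subst hl) <;>
          first | exact ⟨0, rfl⟩ | exact ⟨1, rfl⟩ | omega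
      · rintro ⟨j, rfl⟩
        fin_cases j <;> rfl
    · refine (congrArg (IsDirectSumOf _) (funext fun j => ?_)).mpr (h2 i h hne)
      fin_cases j <;> rfl
  · refine ⟨Fin 2 ⊕ Set.Icc 1 (padicValNat 2 (orderOf (σ ^ i)) - 1),
      Sum.elim (fun j => .fourV i hi' h j) (fun j => .fourE i hi' h j j.2), fun l => ?_, ?_⟩
    · constructor
      · intro hl
        cases l <;> simp only [SummandLabel.index] at hl <;> (try subst hl) <;>
          first | exact ⟨.inl _, rfl⟩ | exact ⟨.inr ⟨_, by assumption⟩, rfl⟩ | omega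
      · rintro ⟨j | j, rfl⟩ <;> rfl
    · refine (congrArg (IsDirectSumOf _) (funext fun j => ?_)).mpr (h4 i h)
      rcases j with j | j <;> rfl

end Labels

/-! ### Irreducibility of prime cyclotomic polynomials over number fields. -/

section CyclotomicIrreducibility

open Polynomial NumberField

/-- If `P²` divides `p`, then `P` divides the different and so contains its norm; that norm is
coprime to `p ∈ P`, giving `1 ∈ P`. -/
theorem natCast_notMem_sq_of_not_dvd_absNorm_differentIdeal {F : Type*} [Field F] [NumberField F]
    {p : ℕ} (hp : p.Prime) (hpD : ¬ p ∣ Ideal.absNorm (differentIdeal ℤ (𝓞 F))) {P : Ideal (𝓞 F)}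
    (hP : P.IsPrime) (hpP : (p : 𝓞 F) ∈ P) : (p : 𝓞 F) ∉ P ^ 2 := by
  intro h2
  have hmax : (Ideal.span {(p : ℤ)}).IsMaximal :=
    PrincipalIdealRing.isMaximal_of_irreducible (Nat.prime_iff_prime_int.1 hp).irreducible
  have hdvd : P ^ 2 ∣ (Ideal.span {(p : ℤ)}).map (algebraMap ℤ (𝓞 F)) := by
    rw [Ideal.map_span, Set.image_singleton, Ideal.dvd_span_singleton]
    simpa using h2
  have hD := pow_sub_one_dvd_differentIdeal (A := ℤ) P 2
    (by simpa using hp.ne_zero) hdvd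
  rw [Nat.add_one_sub_one, pow_one, Ideal.dvd_iff_le] at hD
  have hN := hD (Ideal.absNorm_mem (differentIdeal ℤ (𝓞 F)))
  refine hP.ne_top ((Ideal.eq_top_iff_one _).2 ?_)
  obtain ⟨u, v, huv⟩ := ((Nat.Prime.coprime_iff_not_dvd hp).2 hpD).isCoprime
  have h1 := congrArg (Int.cast : ℤ → 𝓞 F) huv
  push_cast at h1
  rw [← h1]
  exact P.add_mem (P.mul_mem_left _ hpP) (P.mul_mem_left _ hN)

/-- `Φ_p(X + 1)` is Eisenstein at `P`: its lower coefficients are multiples of `p` already over the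
integers, and its constant term is `Φ_p(1) = p`. Gauss's lemma for monic polynomials over an
integrally closed domain passes to `F`. -/
theorem irreducible_cyclotomic_of_notMem_sq {R F : Type*} [CommRing R] [IsDomain R]
    [IsIntegrallyClosed R] [Field F] [Algebra R F] [IsFractionRing R F] {p : ℕ} (hp : p.Prime)
    {P : Ideal R} (hP : P.IsPrime) (hpP : (p : R) ∈ P) (hpP2 : (p : R) ∉ P ^ 2) :
    Irreducible (cyclotomic p F) := by
  have : Fact p.Prime := ⟨hp⟩
  rw [← map_cyclotomic p (algebraMap R F),
    ← (cyclotomic.monic p R).irreducible_iff_irreducible_map_fraction_map]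
  have hmap : ((cyclotomic p ℤ).comp (X + 1)).map (Int.castRingHom R) =
      (cyclotomic p R).comp (X + 1) := by
    rw [Polynomial.map_comp, map_cyclotomic]; simp
  have hmonic : ((cyclotomic p R).comp (X + 1)).Monic := by
    rw [← C_1]
    refine (cyclotomic.monic p R).comp (monic_X_add_C 1) ?_
    rw [natDegree_X_add_C]; exact one_ne_zero
  have hdeg : ((cyclotomic p R).comp (X + 1)).natDegree = p - 1 := by
    rw [← C_1, natDegree_comp, natDegree_X_add_C, mul_one, natDegree_cyclotomic,
      Nat.totient_prime hp]
  have hdegZ : ((cyclotomic p ℤ).comp (X + 1)).natDegree = p - 1 := by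
    rw [← C_1, natDegree_comp, natDegree_X_add_C, mul_one, natDegree_cyclotomic,
      Nat.totient_prime hp]
  have hE : ((cyclotomic p R).comp (X + 1)).IsEisensteinAt P := by
    refine hmonic.isEisensteinAt_of_mem_of_notMem hP.ne_top (fun {n} hn => ?_) ?_
    · have h := (cyclotomic_comp_X_add_one_isEisensteinAt p).mem (n := n) (by omega)
      rw [Ideal.submodule_span_eq, Ideal.mem_span_singleton] at h
      obtain ⟨a, ha⟩ := h
      rw [← hmap, coeff_map, ha, map_mul]
      refine P.mul_mem_right _ ?_
      simpa using hpP
    · rw [coeff_zero_eq_eval_zero, eval_comp]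
      simpa [eval_one_cyclotomic_prime] using hpP2
  have hirr := hE.irreducible hP hmonic.isPrimitive (by rw [hdeg]; have := hp.two_le; omega)
  have h2 : algEquivAevalXAddC (1 : R) (cyclotomic p R) = (cyclotomic p R).comp (X + 1) := by
    rw [← C_1]
    simp [comp_eq_aeval]
  rw [← h2] at hirr
  exact (MulEquiv.irreducible_iff (algEquivAevalXAddC (1 : R))).1 hirr

/-- Cyclotomic polynomials of large prime index stay irreducible over a number field. -/
theorem exists_forall_prime_gt_irreducible_cyclotomic (F : Type*) [Field F] [NumberField F] :
    ∃ N : ℕ, ∀ p : ℕ, p.Prime → N < p → Irreducible (cyclotomic p F) := by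
  have hD : Ideal.absNorm (differentIdeal ℤ (𝓞 F)) ≠ 0 :=
    fun h => differentIdeal_ne_bot (Ideal.absNorm_eq_zero_iff.1 h)
  refine ⟨Ideal.absNorm (differentIdeal ℤ (𝓞 F)), fun p hp hlt => ?_⟩
  have hunit : ¬ IsUnit (p : 𝓞 F) := fun h => by
    have h1 : IsUnit (Algebra.norm ℤ (algebraMap ℤ (𝓞 F) p)) := by
      rw [map_natCast]; exact h.map _
    rw [Algebra.norm_algebraMap, isUnit_pow_iff Module.finrank_pos.ne'] at h1
    exact (Nat.prime_iff_prime_int.1 hp).not_isUnit h1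
  obtain ⟨P, hP, hpP⟩ := Ideal.exists_le_maximal (Ideal.span {(p : 𝓞 F)})
    (fun h => hunit (Ideal.span_singleton_eq_top.1 h))
  rw [Ideal.span_singleton_le_iff_mem] at hpP
  exact irreducible_cyclotomic_of_notMem_sq hp hP.isPrime hpP
    (natCast_notMem_sq_of_not_dvd_absNorm_differentIdeal hp
      (fun h => (Nat.le_of_dvd (Nat.pos_of_ne_zero hD) h).not_gt hlt) hP.isPrime hpP)

end CyclotomicIrreducibility

/-! ### Cyclic extensions in which -1 is not a square. -/

section CyclicExtensions

open Polynomial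

theorem exists_isCyclic_intermediateField {K E : Type*} [Field K] [Field E] [Algebra K E]
    [FiniteDimensional K E] [IsGalois K E] [IsCyclic (E ≃ₐ[K] E)] {n : ℕ}
    (hn : n ∣ Module.finrank K E) :
    ∃ L : IntermediateField K E, IsGalois K L ∧ IsCyclic (L ≃ₐ[K] L) ∧ Module.finrank K L = n := by
  obtain ⟨g, hg⟩ := IsCyclic.exists_generator (α := E ≃ₐ[K] E)
  have hog : orderOf g = Module.finrank K E := by
    rw [orderOf_eq_card_of_forall_mem_zpowers hg, IsGalois.card_aut_eq_finrank]
  have hpos : 0 < Module.finrank K E := Module.finrank_pos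
  have hn0 : n ≠ 0 := by rintro rfl; exact hpos.ne' (zero_dvd_iff.1 hn)
  let : CommGroup (E ≃ₐ[K] E) := IsCyclic.commGroup
  have hnormal : (Subgroup.zpowers (g ^ n)).Normal :=
    ⟨fun x hx y => by rwa [mul_comm y x, mul_inv_cancel_right]⟩
  -- The subgroup generated by `g^n` has index `n`, and the Galois group of its fixed field is a
  -- quotient of a cyclic group.
  refine ⟨IntermediateField.fixedField (Subgroup.zpowers (g ^ n)), inferInstance, ?_, ?_⟩
  · exact isCyclic_of_surjective _ (AlgEquiv.restrictNormalHom_surjective (F := K)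
      (K₁ := IntermediateField.fixedField (Subgroup.zpowers (g ^ n))) E)
  · have h1 := Module.finrank_mul_finrank K
      (IntermediateField.fixedField (Subgroup.zpowers (g ^ n))) E
    rw [IntermediateField.finrank_fixedField_eq_card, Nat.card_zpowers, orderOf_pow_of_dvd hn0
      (by rwa [hog]), hog] at h1
    obtain ⟨m, hm⟩ := hn
    rw [hm, Nat.mul_div_cancel_left _ (Nat.pos_of_ne_zero hn0)] at h1
    refine Nat.eq_of_mul_eq_mul_right ?_ h1
    rw [hm] at hpos
    exact Nat.pos_of_mul_pos_left hpos

/-- If the `p`-th cyclotomic polynomial is irreducible over the quadratic extension `F = K(√-1)`,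
then `-1` is not a square in `K(ζ_p)`. -/
theorem not_isSquare_neg_one_adjoin_of_irreducible {K F M : Type*} [Field K] [Field F] [Field M]
    [Algebra K F] [Algebra F M] [Algebra K M] [IsScalarTower K F M] [CharZero K]
    [FiniteDimensional K F] {p : ℕ} [NeZero p] [IsCyclotomicExtension {p} F M]
    (hirr : Irreducible (cyclotomic p F)) {i : F} (hi : i ^ 2 = -1)
    (htop : Algebra.adjoin K {i} = ⊤) (hF : Module.finrank K F ≠ 1) {ζ : M}
    (hζ : IsPrimitiveRoot ζ p) : ¬ IsSquare (-1 : IntermediateField.adjoin K {ζ}) := by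
  have : CharZero F := charZero_of_injective_algebraMap (algebraMap K F).injective
  have : FiniteDimensional F M := IsCyclotomicExtension.finiteDimensional {p} F M
  have : FiniteDimensional K M := FiniteDimensional.trans K F M
  have hirrK : Irreducible (cyclotomic p K) := by
    rw [← map_cyclotomic p (algebraMap K F)] at hirr
    exact (cyclotomic.monic p K).irreducible_of_irreducible_map _ _ hirr
  have := hζ.intermediateField_adjoin_isCyclotomicExtension K
  set L := IntermediateField.adjoin K {ζ} with hL
  rintro ⟨y, hy⟩
  have hiL : algebraMap F M i ∈ L := by
    have h1 : (y : M) ^ 2 = (algebraMap F M i) ^ 2 := by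
      rw [← map_pow, hi, sq, map_neg, map_one]
      have := congrArg (Subtype.val) hy
      simpa using this.symm
    rcases sq_eq_sq_iff_eq_or_eq_neg.1 h1 with h | h
    · rw [← h]; exact y.2
    · rw [← neg_eq_iff_eq_neg.2 h]; exact L.neg_mem y.2
  have hFL : ∀ x : F, algebraMap F M x ∈ L := fun x => by
    have h1 : Algebra.adjoin K {i} ≤ L.toSubalgebra.comap (IsScalarTower.toAlgHom K F M) :=
      Algebra.adjoin_le (Set.singleton_subset_iff.2 hiL)
    rw [htop] at h1
    exact h1 (Algebra.mem_top (x := x))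
  -- A square root of -1 in `K(ζ)` gives `F ⊆ K(ζ)`, hence `K(ζ) = F(ζ)`. Both have degree `φ(p)`
  -- over their own base, which forces `[F : K] = 1`.
  have hLtop : L = ⊤ := by
    rw [eq_top_iff]
    intro z _
    have hz : z ∈ Algebra.adjoin F {ζ} := by
      rw [IsCyclotomicExtension.adjoin_primitive_root_eq_top hζ]; trivial
    induction hz using Algebra.adjoin_induction with
    | mem x hx => exact IntermediateField.subset_adjoin K _ hx
    | algebraMap x => exact hFL x
    | add x y _ _ hx hy => exact L.add_mem (hx trivial) (hy trivial)
    | mul x y _ _ hx hy => exact L.mul_mem (hx trivial) (hy trivial)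
  have h1 : Module.finrank K L = p.totient := IsCyclotomicExtension.finrank L hirrK
  have h2 : Module.finrank F M = p.totient := IsCyclotomicExtension.finrank M hirr
  have h3 := Module.finrank_mul_finrank K F M
  rw [hLtop, IntermediateField.finrank_top'] at h1
  rw [h1, h2] at h3
  exact hF (Nat.eq_of_mul_eq_mul_right (Nat.totient_pos.2 (NeZero.pos p)) (by rw [h3, one_mul]))

theorem exists_isCyclic_extension_not_isSquare_neg_one (K : Type u) [Field K] [NumberField K]
    (hK : ¬ IsSquare (-1 : K)) {n : ℕ} (hn : n ≠ 0) :
    ∃ (L : Type u) (_ : Field L) (_ : Algebra K L),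
      IsGalois K L ∧ IsCyclic (L ≃ₐ[K] L) ∧ Module.finrank K L = n ∧ ¬ IsSquare (-1 : L) := by
  have hdeg : (X ^ 2 + 1 : K[X]).natDegree = 2 := by compute_degree!
  have hirr2 : Irreducible (X ^ 2 + 1 : K[X]) := by
    rw [irreducible_iff_roots_eq_zero_of_degree_le_three (by omega) (by omega)]
    rw [Multiset.eq_zero_iff_forall_notMem]
    intro a ha
    have h := isRoot_of_mem_roots ha
    rw [IsRoot.def, eval_add, eval_pow, eval_X, eval_one] at h
    exact hK ⟨a, by rw [← sq]; exact (eq_neg_of_add_eq_zero_left h).symm⟩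
  have : Fact (Irreducible (X ^ 2 + 1 : K[X])) := ⟨hirr2⟩
  let F := AdjoinRoot (X ^ 2 + 1 : K[X])
  have : FiniteDimensional K F := (AdjoinRoot.powerBasis hirr2.ne_zero).finite
  have hF : Module.finrank K F = 2 := by
    rw [(AdjoinRoot.powerBasis hirr2.ne_zero).finrank, AdjoinRoot.powerBasis_dim, hdeg]
  have : NumberField F := NumberField.of_module_finite K F
  obtain ⟨N, hN⟩ := exists_forall_prime_gt_irreducible_cyclotomic F
  -- `p > N` keeps `Φ_p` irreducible over `F`; `p ≡ 1 mod n` makes `n` divide `[K(ζ_p) : K] = p -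
  -- 1`.
  obtain ⟨p, hp, hpN, hpn⟩ := Nat.exists_prime_gt_modEq_one N hn
  have : NeZero p := ⟨hp.ne_zero⟩
  have : Fact p.Prime := ⟨hp⟩
  have hirr := hN p hp hpN
  let M := CyclotomicField p F
  have hζ := IsCyclotomicExtension.zeta_spec p F M
  set ζ := IsCyclotomicExtension.zeta p F M
  have hi : (AdjoinRoot.root (X ^ 2 + 1 : K[X])) ^ 2 = -1 := by
    have := AdjoinRoot.eval₂_root (X ^ 2 + 1 : K[X])
    rw [eval₂_add, eval₂_pow, eval₂_X, eval₂_one] at this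
    exact eq_neg_of_add_eq_zero_left this
  have hsq := not_isSquare_neg_one_adjoin_of_irreducible (K := K) hirr hi
    AdjoinRoot.adjoinRoot_eq_top (by rw [hF]; decide) hζ
  have : FiniteDimensional F M := IsCyclotomicExtension.finiteDimensional {p} F M
  have : FiniteDimensional K M := FiniteDimensional.trans K F M
  have hcyc := hζ.intermediateField_adjoin_isCyclotomicExtension K
  have hirrK : Irreducible (cyclotomic p K) := by
    rw [← map_cyclotomic p (algebraMap K F)] at hirr
    exact (cyclotomic.monic p K).irreducible_of_irreducible_map _ _ hirr
  set E := IntermediateField.adjoin K {ζ}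
  have : IsGalois K E := IsCyclotomicExtension.isGalois {p} K E
  have : IsCyclic (E ≃ₐ[K] E) :=
    isCyclic_of_surjective _ (IsCyclotomicExtension.autEquivPow E hirrK).symm.surjective
  have hE : Module.finrank K E = p - 1 := by
    rw [IsCyclotomicExtension.finrank E hirrK, Nat.totient_prime hp]
  obtain ⟨L, h1, h2, h3⟩ := exists_isCyclic_intermediateField (K := K) (E := E) (n := n)
    (by rw [hE]; exact (Nat.modEq_iff_dvd' hp.one_le).1 hpn.symm)
  refine ⟨L, inferInstance, inferInstance, h1, h2, h3, fun ⟨y, hy⟩ => hsq ⟨y, ?_⟩⟩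
  have := congrArg (Subtype.val) hy
  simpa using this

end CyclicExtensions
-- The main theorem.
theorem mainTheorem8 (K : Type u) [Field K] [NumberField K] (hK : ¬ IsSquare (-1 : K))
    (n α k : ℕ) (hα : 2 ≤ α) (hk : Odd k) (hn : n = 2 ^ α * k) :
    -- cyclic extensions of degree `n` in which `-1` is not a square exist
    (∃ (L : Type u) (_ : Field L) (_ : Algebra K L),
      IsGalois K L ∧ IsCyclic (L ≃ₐ[K] L) ∧ Module.finrank K L = n ∧ ¬ IsSquare (-1 : L)) ∧
    -- and for each of them the decompositions hold
    (∀ (L : Type v) [Field L] [Algebra K L] [IsGalois K L] (σ : L ≃ₐ[K] L),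
      (∀ τ : L ≃ₐ[K] L, τ ∈ Subgroup.zpowers σ) →
      Module.finrank K L = n →
      ¬ IsSquare (-1 : L) →
      ∃ (U V : ℕ → Submodule K (LinearMap.BilinForm K L))
        (V' : ℕ → Fin 2 → Submodule K (LinearMap.BilinForm K L))
        (E : ℕ → ℕ → Submodule K (LinearMap.BilinForm K L)),
        -- the components with `ord(σ^i) = 2^β k'`, `β ≥ 2`, `k'` odd
        (∀ i β k' : ℕ, 2 ≤ β → Odd k' → orderOf (σ ^ i) = 2 ^ β * k' →
          IsDirectSumOf (skewSpace (σ ^ i))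
            (Sum.elim (V' i) (fun j : Set.Icc 1 (β - 1) => E i (j : ℕ))) ∧
          (∀ j ∈ Set.Icc 1 (β - 1), IsRankSubspace (E i j) n (n / 2 ^ j)) ∧
          (∀ j : Fin 2, IsRankSubspace (V' i j) (n - 2 * n / orderOf (σ ^ i))
            (k' * n / orderOf (σ ^ i)))) ∧
        -- the components with `ord(σ^i) ≡ 2 mod 4`, `ord(σ^i) ≠ 2`
        (∀ i : ℕ, orderOf (σ ^ i) % 4 = 2 → orderOf (σ ^ i) ≠ 2 →
          IsDirectSumOf (skewSpace (σ ^ i)) ![U i, V i] ∧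
          IsRankSubspace (U i) n (n / 2) ∧
          IsRankSubspace (V i) (n - 2 * n / orderOf (σ ^ i)) (n / 2)) ∧
        -- the components with `ord(σ^i)` odd, `σ^i ≠ 1`
        (∀ i : ℕ, orderOf (σ ^ i) % 2 = 1 → orderOf (σ ^ i) ≠ 1 →
          IsRankSubspace (skewSpace (σ ^ i)) (n - n / orderOf (σ ^ i)) n) ∧
        -- the component of the involution
        IsRankSubspace (skewSpace (σ ^ (n / 2))) n (n / 2) ∧
        -- the full decomposition
        IsDirectSumOf (altForms K L) (summand n σ U V V' E)) := by
  have hk0 : 0 < k := hk.pos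
  have hn4 : 4 ∣ n := by
    rw [hn]; exact Dvd.dvd.mul_right (pow_dvd_pow 2 hα) k
  have hn0 : 0 < n := by rw [hn]; positivity
  refine ⟨exists_isCyclic_extension_not_isSquare_neg_one K hK hn0.ne', ?_⟩
  intro L _ _ _ σ hσ hfin hL
  have : FiniteDimensional K L := Module.finite_of_finrank_pos (by omega)
  have ho : orderOf σ = n := by
    rw [orderOf_eq_card_of_forall_mem_zpowers hσ, IsGalois.card_aut_eq_finrank, hfin]
  have hinv : orderOf (σ ^ (n / 2)) = 2 := orderOf_pow_of_eq_mul (by omega) (by omega)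
  have h4 := fun (i β k' : ℕ) (hβ : 2 ≤ β) (hk' : Odd k') (hi : orderOf (σ ^ i) = 2 ^ β * k') =>
    twoPartSummand_spec hL hβ hk' hi
  have h2 := fun (i : ℕ) (h : orderOf (σ ^ i) % 4 = 2) (hne : orderOf (σ ^ i) ≠ 2) =>
    halfOrderSummand_spec h hne
  refine ⟨fun i => halfOrderSummand (σ ^ i) (-1 : K), fun i => halfOrderSummand (σ ^ i) (1 : K),
    fun i => oddPartSummand (σ ^ i), fun i => twoPartSummand (σ ^ i), ?_, ?_, ?_, ?_, ?_⟩
  · rw [← hfin]; exact h4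
  · rw [← hfin]; exact h2
  · rw [← hfin]; exact fun i h hne => isRankSubspace_skewSpace_of_odd (Nat.odd_iff.2 h) hne
  · have := isRankSubspace_skewSpace_of_sq_eq_one hinv
    rwa [hfin] at this
  · refine isDirectSumOf_summand (m := n / 2) (by omega) (by omega) ho
      (isDirectSumOf_altForms hσ (by omega)) (fun i hi => ?_) fun i h hne => (h2 i h hne).1
    have hpos : orderOf (σ ^ i) ≠ 0 := (orderOf_pos _).ne'
    obtain ⟨β, k', hk', hfac⟩ := Nat.exists_eq_two_pow_mul_odd hpos
    have hβ : padicValNat 2 (orderOf (σ ^ i)) = β := by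
      rw [hfac, padicValNat.mul (by positivity) hk'.pos.ne', padicValNat.prime_pow,
        padicValNat.eq_zero_of_not_dvd hk'.not_two_dvd_nat, add_zero]
    have hβ2 : 2 ≤ β := by
      rw [← hβ]
      exact (padicValNat_dvd_iff_le hpos).1 (Nat.dvd_of_mod_eq_zero hi)
    rw [hβ]
    exact (h4 i β k' hβ2 hk' hfac).1
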